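/- For an open set $U\subset\mathbb C$, a weight on $U$ is a continuous, bounded, strictly positive function $v\colon U\to\mathbb R$. Let $\mathcal H_v(U)$ be the space of holomorphic $f\colon U\to\mathbb C$ with $\|f\|_v:=\sup_{z\in U}v(z)|f(z)|<\infty$, normed by $\|\cdot\|_v$, and let $\mathcal H_{v_o}(U)$ be the subspace of those $f$ for which $v(z)|f(z)|$ converges to $0$ at the boundary of $U$, i.e. for every $\varepsilon>0$ there is a compact $K\subset U$ with $v(z)|f(z)|<\varepsilon$ for all $z\in U\setminus K$. Write $\delta_z$ for evaluation at $z$. The weight $v$ is complete if, for every $z\in U$, the functional $v(z)\delta_z$ is an extreme point of the closed unit ball of the dual space $\mathcal H_{v_o}(U)'$. A subspace $A$ of $\mathcal H_w(V)$ strongly $w$-separates the points of $V$ if for all $x\neq y$ in $V$ there is $f\in A$ with $w(x)|f(x)|\neq w(y)|f(y)|$. **Theorem.** Let $\Delta$ be the open unit disc and let $V$ be a non-empty connected open subset of $\mathbb C$. Let $v$ be a complete weight on $\Delta$ that converges to $0$ on the boundary of $\Delta$ (for every $\varepsilon>0$ there is a compact $K\subset\Delta$ with $v<\varepsilon$ on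 $\Delta\setminus K$), and let $w$ be a weight on $V$ such that $\mathcal H_{w_o}(V)$ contains all polynomials of degree $1$ (restricted to $V$). Let $T\colon\mathcal H_{v_o}(\Delta)\to\mathcal H_{w_o}(V)$ be a ($\mathbb C$-)linear isometry, not assumed surjective. Then the following are equivalent: (a) $T$ is surjective; (b) $T(\mathcal H_{v_o}(\Delta))$ strongly $w$-separates the points of $V$; (c) $T(\mathcal H_{v_o}(\Delta))$ contains all polynomials of degree $1$ (restricted to $V$). -/

import Mathlib

open Filter Topology

noncomputable section

namespace WeightedHol

/-- A weight on `U`: a continuous, bounded, strictly positive real-valued function on `U`. -/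
structure Weight (U : Set ℂ) where
  toFun : U → ℝ
  continuous' : Continuous toFun
  bounded' : ∃ C : ℝ, ∀ z, toFun z ≤ C
  pos' : ∀ z, 0 < toFun z

instance {U : Set ℂ} : CoeFun (Weight U) (fun _ => U → ℝ) := ⟨Weight.toFun⟩

/-- The function `f` on the (open) set `U` is holomorphic. -/
def IsHolomorphic {U : Set ℂ} (f : U → ℂ) : Prop :=
  ∃ F : ℂ → ℂ, DifferentiableOn ℂ F U ∧ ∀ z : U, F z = f z

/-- A real function on `U` converges to `0` at the boundary of `U`: for every `ε > 0` there is a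
compact subset of `U` outside which its absolute value is less than `ε`. -/
def VanishesAtBoundary {U : Set ℂ} (g : U → ℝ) : Prop :=
  Tendsto g (cocompact U) (𝓝 0)

/-- The holomorphic functions `f` on `U` with `sup_{z ∈ U} v(z)|f(z)| < ∞`. -/
def weightedSubmodule {U : Set ℂ} (v : Weight U) : Submodule ℂ (U → ℂ) where
  carrier := {f | IsHolomorphic f ∧ BddAbove (Set.range fun z => v z * ‖f z‖)}
  zero_mem' := by
    refine ⟨⟨fun _ => 0, differentiableOn_const _, fun _ => rfl⟩, 0, ?_⟩
    rintro _ ⟨z, rfl⟩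
    simp
  add_mem' := by
    rintro f g ⟨⟨F, hF, hFf⟩, C, hC⟩ ⟨⟨G, hG, hGg⟩, D, hD⟩
    refine ⟨⟨fun z => F z + G z, hF.add hG, fun z => by simp [hFf, hGg]⟩, C + D, ?_⟩
    rintro _ ⟨z, rfl⟩
    have h1 : v z * ‖f z‖ ≤ C := hC ⟨z, rfl⟩
    have h2 : v z * ‖g z‖ ≤ D := hD ⟨z, rfl⟩
    have h3 := mul_le_mul_of_nonneg_left (norm_add_le (f z) (g z)) (v.pos' z).le
    simp only [Pi.add_apply]
    linarith
  smul_mem' := by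
    rintro c f ⟨⟨F, hF, hFf⟩, C, hC⟩
    refine ⟨⟨fun z => c * F z, hF.const_mul c, fun z => by simp [hFf]⟩, ‖c‖ * C, ?_⟩
    rintro _ ⟨z, rfl⟩
    have h1 : v z * ‖f z‖ ≤ C := hC ⟨z, rfl⟩
    have h2 := mul_le_mul_of_nonneg_left h1 (norm_nonneg c)
    simp only [Pi.smul_apply, smul_eq_mul, norm_mul]
    linarith

/-- The space `H_v(U)`, normed below by `‖f‖_v = sup_{z ∈ U} v(z)|f(z)|`. -/
def H {U : Set ℂ} (v : Weight U) : Type := weightedSubmodule v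

namespace H

variable {U : Set ℂ} {v : Weight U}

instance : AddCommGroup (H v) := inferInstanceAs (AddCommGroup (weightedSubmodule v))

instance : Module ℂ (H v) := inferInstanceAs (Module ℂ (weightedSubmodule v))

instance : CoeFun (H v) (fun _ => U → ℂ) := ⟨fun f => f.1⟩

instance : Norm (H v) := ⟨fun f => ⨆ z : U, v z * ‖f z‖⟩

theorem norm_def (f : H v) : ‖f‖ = ⨆ z : U, v z * ‖f z‖ := rfl

theorem add_apply (f g : H v) (z : U) : (f + g) z = f z + g z := rfl

theorem smul_apply (c : ℂ) (f : H v) (z : U) : (c • f) z = c * f z := rfl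

theorem zero_apply (z : U) : (0 : H v) z = 0 := rfl

theorem weight_mul_le_norm (f : H v) (z : U) : v z * ‖f z‖ ≤ ‖f‖ :=
  le_ciSup (f := fun z : U => v z * ‖f z‖) f.2.2 z

theorem core : NormedSpace.Core ℂ (H v) where
  norm_nonneg f := Real.iSup_nonneg fun z => mul_nonneg (v.pos' z).le (norm_nonneg _)
  norm_smul c f := by
    rw [norm_def, norm_def, Real.mul_iSup_of_nonneg (norm_nonneg c)]
    refine iSup_congr fun z => ?_
    rw [smul_apply, norm_mul]
    ring
  norm_triangle f g := by
    have hf : 0 ≤ ‖f‖ := Real.iSup_nonneg fun z => mul_nonneg (v.pos' z).le (norm_nonneg _)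
    have hg : 0 ≤ ‖g‖ := Real.iSup_nonneg fun z => mul_nonneg (v.pos' z).le (norm_nonneg _)
    refine Real.iSup_le (fun z => ?_) (add_nonneg hf hg)
    have h3 := mul_le_mul_of_nonneg_left (norm_add_le (f z) (g z)) (v.pos' z).le
    have h1 := weight_mul_le_norm f z
    have h2 := weight_mul_le_norm g z
    rw [add_apply]
    linarith
  norm_eq_zero_iff f := by
    constructor
    · intro h
      refine Subtype.ext (funext fun z => ?_)
      have h1 := weight_mul_le_norm f z
      rw [h] at h1
      have h2 : ‖f z‖ ≤ 0 := by
        by_contra! hlt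
        exact absurd h1 (not_le.mpr (mul_pos (v.pos' z) hlt))
      exact norm_le_zero_iff.mp h2
    · rintro rfl
      simp [norm_def, zero_apply]

instance : NormedAddCommGroup (H v) := NormedAddCommGroup.ofCore core

instance : NormedSpace ℂ (H v) := NormedSpace.ofCore core

end H

variable {U : Set ℂ}

/-- The subspace `H_{v_o}(U)` of those `f` in `H_v(U)` for which `v(z)|f(z)|` converges to `0` as
`z` converges to the boundary of `U`. -/
def Ho (v : Weight U) : Submodule ℂ (H v) where
  carrier := {f | VanishesAtBoundary fun z => v z * ‖f z‖}
  zero_mem' := by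
    simpa [VanishesAtBoundary, H.zero_apply] using tendsto_const_nhds
  add_mem' := by
    intro f g hf hg
    have h := Tendsto.add (show Tendsto _ _ _ from hf) (show Tendsto _ _ _ from hg)
    rw [add_zero] at h
    refine squeeze_zero (fun z => mul_nonneg (v.pos' z).le (norm_nonneg _)) (fun z => ?_) h
    rw [H.add_apply]
    have h3 := mul_le_mul_of_nonneg_left (norm_add_le (f z) (g z)) (v.pos' z).le
    linarith
  smul_mem' := by
    intro c f hf
    have h := Tendsto.const_mul ‖c‖ (show Tendsto _ _ _ from hf)
    rw [mul_zero] at h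
    refine h.congr fun z => ?_
    rw [H.smul_apply, norm_mul]
    ring

/-- The evaluation functional `δ_z` in the dual of `H_{v_o}(U)`. -/
def delta (v : Weight U) (z : U) : StrongDual ℂ (Ho v) :=
  LinearMap.mkContinuous
    { toFun := fun f => f.1 z
      map_add' := fun _ _ => rfl
      map_smul' := fun _ _ => rfl } (v z)⁻¹ (fun f => by
        rw [← div_eq_inv_mul, le_div_iff₀ (v.pos' z), mul_comm]
        exact H.weight_mul_le_norm f.1 z)

/-- The `v`-boundary of `U`: the points `z` for which `v(z)δ_z` is an extreme point of the closed
unit ball of the dual of `H_{v_o}(U)`. -/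
def vBoundary (v : Weight U) : Set U :=
  {z | (v z : ℂ) • delta v z ∈
    Set.extremePoints ℝ (Metric.closedBall (0 : StrongDual ℂ (Ho v)) 1)}

/-- A weight is complete if its `v`-boundary is all of `U`. -/
def Weight.IsComplete (v : Weight U) : Prop := vBoundary v = Set.univ

/-- The subspace `A` of `H_w(V)` strongly `w`-separates the points of `V`. -/
def StronglySeparates {V : Set ℂ} (w : Weight V) (A : Submodule ℂ (H w)) : Prop :=
  ∀ x y : V, x ≠ y → ∃ f ∈ A, w x * ‖f x‖ ≠ w y * ‖f y‖

/-- The subspace `A` of `H_w(V)` contains (the restrictions to `V` of) all polynomials of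
degree `1`. -/
def ContainsDegreeOne {V : Set ℂ} {w : Weight V} (A : Submodule ℂ (H w)) : Prop :=
  ∀ p : Polynomial ℂ, p.degree = 1 → ∃ f ∈ A, ∀ z : V, f z = p.eval (z : ℂ)

/-- The open unit disc. -/
abbrev disc : Set ℂ := Metric.ball 0 1

/-- The range of a linear isometry `H_{v_o}(U) → H_{w_o}(V)`, as a subspace of `H_w(V)`. -/
def rangeIn {V : Set ℂ} {v : Weight U} {w : Weight V} (T : Ho v →ₗᵢ[ℂ] Ho w) :
    Submodule ℂ (H w) :=
  (LinearMap.range T.toLinearMap).map (Ho w).subtype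

end WeightedHol

end

/-! The substance is that strong separation forces surjectivity. The functionals `w(y)δ_y ∘ T`,
their unimodular multiples and `0` form a weak-* compact balanced norming set, so by Hahn–Banach its
closed convex hull is the dual unit ball, and by Milman's theorem it contains every extreme point.
Completeness of `v` thus yields a map `Ψ` from the disc to `V` with `c(z) w(Ψ z) (Tf)(Ψ z) = v(z)
f(z)`, `|c(z)| = 1` (`exists_eval_of_mem_vBoundary`). With `h = T 1`, this reads `(Tf) ∘ Ψ = f · (h
∘ Ψ)`, so `Ψ` is a right inverse of the meromorphic function `T(id) / h`.

Separation makes `Ψ` continuous, hence holomorphic and open. As `v` vanishes at the boundary, the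
image is relatively closed off the zeros of `h`; those zeros are isolated and are handled by
removable singularities and the maximum principle. So `Ψ` is onto (`subset_image_disc_of_mul_eq`),
and `(g ∘ Ψ) / (h ∘ Ψ)` is a preimage of `g`. -/

noncomputable section

namespace WeightedHol

/-! ### Milman's theorem and Hahn–Banach separation -/

section Milman

variable {E : Type*} [AddCommGroup E] [Module ℝ E] [TopologicalSpace E]
  [IsTopologicalAddGroup E] [ContinuousSMul ℝ E]

theorem isCompact_convexJoin {s t : Set E} (hs : IsCompact s) (ht : IsCompact t) :
    IsCompact (convexJoin ℝ s t) := by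
  have h : convexJoin ℝ s t =
      (fun p : ℝ × E × E => (1 - p.1) • p.2.1 + p.1 • p.2.2) '' (Set.Icc 0 1 ×ˢ s ×ˢ t) := by
    ext x
    simp only [mem_convexJoin, segment_eq_image, Set.mem_image, Set.mem_prod, Prod.exists]
    grind
  rw [h]
  exact (isCompact_Icc.prod (hs.prod ht)).image (by fun_prop)

/-- **Milman's theorem**: an extreme point of a compact closed convex hull of a compact set
belongs to the set. -/
theorem mem_of_mem_extremePoints_closure_convexHull [T2Space E] [LocallyConvexSpace ℝ E]
    {K : Set E} (hK : IsCompact K) (hC : IsCompact (closure (convexHull ℝ K))) {x : E}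
    (hx : x ∈ Set.extremePoints ℝ (closure (convexHull ℝ K))) : x ∈ K := by
  by_contra hxK
  set C := closure (convexHull ℝ K) with hCdef
  have hKC : K ⊆ C := (subset_convexHull ℝ K).trans subset_closure
  have hCc : Convex ℝ C := (convex_convexHull ℝ K).closure
  obtain ⟨D, hDc, hDv, -, hKD, hxD⟩ : ∃ D : Set E,
      IsCompact D ∧ Convex ℝ D ∧ D ⊆ C ∧ K ⊆ D ∧ x ∉ D := by
    -- Compactness reduces the claim to small pieces of `K`, which closed convex neighbourhoods
    -- separate from `x`. Two such `D` merge into their convex join, which misses `x` because an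
    -- extreme point on a segment is one of its endpoints.
    refine hK.induction_on (p := fun A => ∃ D : Set E,
      IsCompact D ∧ Convex ℝ D ∧ D ⊆ C ∧ A ⊆ D ∧ x ∉ D) ?_ ?_ ?_ ?_
    · exact ⟨∅, isCompact_empty, convex_empty, by simp, by simp, by simp⟩
    · rintro s t hst ⟨D, h1, h2, h3, h4, h5⟩
      exact ⟨D, h1, h2, h3, hst.trans h4, h5⟩
    · rintro s t ⟨D, h1, h2, h3, h4, h5⟩ ⟨D', h1', h2', h3', h4', h5'⟩
      rcases D.eq_empty_or_nonempty with rfl | hD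
      · exact ⟨D', h1', h2', h3', Set.union_subset (h4.trans (by simp)) h4', h5'⟩
      rcases D'.eq_empty_or_nonempty with rfl | hD'
      · exact ⟨D, h1, h2, h3, Set.union_subset h4 (h4'.trans (by simp)), h5⟩
      refine ⟨convexJoin ℝ D D', isCompact_convexJoin h1 h1', h2.convexJoin h2',
        convexJoin_subset h3 h3' hCc, Set.union_subset (h4.trans (subset_convexJoin_left hD'))
          (h4'.trans (subset_convexJoin_right hD)), fun hxj => ?_⟩
      obtain ⟨a, ha, b, hb, hab⟩ := mem_convexJoin.1 hxj
      rcases (mem_extremePoints_iff_forall_segment.1 hx).2 a (h3 ha) b (h3' hb) hab with h | h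
      · exact h5 (h ▸ ha)
      · exact h5' (h ▸ hb)
    · intro k hk
      have hkx : ({x}ᶜ : Set E) ∈ 𝓝 k :=
        isOpen_compl_singleton.mem_nhds (fun h => hxK ((Set.mem_singleton_iff.1 h) ▸ hk))
      obtain ⟨N, hN, hNc, hNx⟩ := exists_mem_nhds_isClosed_subset hkx
      obtain ⟨M, ⟨hM, hMv⟩, hMN⟩ :=
        (LocallyConvexSpace.convex_basis (𝕜 := ℝ) k).mem_iff.1 hN
      have hMN' : closure M ⊆ N := closure_minimal hMN hNc
      refine ⟨K ∩ M, Filter.inter_mem self_mem_nhdsWithin (mem_nhdsWithin_of_mem_nhds hM),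
        C ∩ closure M, hC.inter_right isClosed_closure, hCc.inter hMv.closure,
        Set.inter_subset_left, Set.inter_subset_inter hKC subset_closure, fun h => ?_⟩
      exact hNx (hMN' h.2) rfl
  exact hxD (closure_minimal (convexHull_min hKD hDv) hDc.isClosed hx.1)

theorem exists_re_lt_of_notMem_closure_convexHull [Module ℂ E] [IsScalarTower ℝ ℂ E]
    [ContinuousSMul ℂ E] [LocallyConvexSpace ℝ E] {K : Set E} {x : E}
    (hx : x ∉ closure (convexHull ℝ K)) :
    ∃ (F : StrongDual ℂ E) (u : ℝ), (∀ a ∈ K, (F a).re < u) ∧ u < (F x).re := by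
  obtain ⟨F, u, hF, hu⟩ := RCLike.geometric_hahn_banach_closed_point (𝕜 := ℂ)
    (convex_convexHull ℝ K).closure isClosed_closure hx
  exact ⟨F, u, fun a ha => hF a (subset_closure (subset_convexHull ℝ K ha)), hu⟩

end Milman

/-! ### Extreme points of the dual ball and norming sets -/

section Dual

variable {X : Type*} [NormedAddCommGroup X] [NormedSpace ℂ X]

instance weakDual_locallyConvexSpace : LocallyConvexSpace ℝ (WeakDual ℂ X) :=
  inferInstanceAs (LocallyConvexSpace ℝ (WeakBilin (topDualPairing ℂ X)))

instance weakDual_isScalarTower : IsScalarTower ℝ ℂ (WeakDual ℂ X) :=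
  inferInstanceAs (IsScalarTower ℝ ℂ (StrongDual ℂ X))

/-- Weak-* separation: the closed unit ball of the dual is contained in the weak-* closed convex
hull of any balanced norming set. -/
theorem mem_closure_convexHull_of_norming {K : Set (WeakDual ℂ X)}
    (hbal : ∀ c : ℂ, ‖c‖ = 1 → ∀ k ∈ K, c • k ∈ K)
    (hnorm : ∀ (f : X) (C : ℝ), (∀ k ∈ K, ‖k f‖ ≤ C) → ‖f‖ ≤ C)
    {φ : WeakDual ℂ X} (hφ : ∀ f, ‖φ f‖ ≤ ‖f‖) : φ ∈ closure (convexHull ℝ K) := by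
  by_contra hmem
  obtain ⟨F, u, hF, hu⟩ := exists_re_lt_of_notMem_closure_convexHull hmem
  -- Weak-* continuous functionals are evaluations at some `f`; rotating each `k` turns the bound on
  -- `re (k f)` into one on `‖k f‖`.
  obtain ⟨f, hf⟩ := LinearMap.dualEmbedding_surjective (topDualPairing ℂ X) F
  have hFf : ∀ k : WeakDual ℂ X, F k = k f := fun k => by rw [← hf]; rfl
  have hle : ‖f‖ ≤ u := by
    refine hnorm f u fun k hk => ?_
    obtain ⟨c, hc, hck⟩ : ∃ c : ℂ, ‖c‖ = 1 ∧ c * k f = ‖k f‖ := by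
      by_cases h0 : k f = 0
      · exact ⟨1, by simp, by simp [h0]⟩
      · have hn : (‖k f‖ : ℂ) ≠ 0 := by simpa using h0
        refine ⟨(‖k f‖ : ℂ) / k f, by simp [h0], div_mul_cancel₀ _ h0⟩
    have h1 := hF (c • k) (hbal c hc k hk)
    rw [hFf] at h1
    have h2 : (c • k) f = (‖k f‖ : ℂ) := by rw [← hck]; rfl
    rw [h2] at h1
    simpa using h1.le
  have h3 : (F φ).re ≤ ‖φ f‖ := by rw [hFf]; exact Complex.re_le_norm _
  linarith [hφ f]

theorem mem_of_mem_extremePoints_closedBall {K : Set (WeakDual ℂ X)} (hK : IsCompact K)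
    (hbal : ∀ c : ℂ, ‖c‖ = 1 → ∀ k ∈ K, c • k ∈ K)
    (hle : ∀ k ∈ K, ∀ f, ‖k f‖ ≤ ‖f‖)
    (hnorm : ∀ (f : X) (C : ℝ), (∀ k ∈ K, ‖k f‖ ≤ C) → ‖f‖ ≤ C)
    {φ : StrongDual ℂ X}
    (hφ : φ ∈ Set.extremePoints ℝ (Metric.closedBall (0 : StrongDual ℂ X) 1)) :
    StrongDual.toWeakDual φ ∈ K := by
  set B : Set (WeakDual ℂ X) := WeakDual.toStrongDual ⁻¹' Metric.closedBall 0 1 with hB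
  have hBmem : ∀ k : WeakDual ℂ X, k ∈ B ↔ ∀ f, ‖k f‖ ≤ ‖f‖ := fun k => by
    rw [hB, Set.mem_preimage, mem_closedBall_zero_iff,
      ContinuousLinearMap.opNorm_le_iff zero_le_one]
    simp
  have hBc : IsCompact B := WeakDual.isCompact_closedBall 0 1
  have hBv : Convex ℝ B := by
    intro a ha b hb s t hs ht hst
    exact convex_closedBall (0 : StrongDual ℂ X) 1 ha hb hs ht hst
  have hhull : closure (convexHull ℝ K) = B := by
    refine Set.Subset.antisymm
      (closure_minimal (convexHull_min (fun k hk => (hBmem k).2 (hle k hk)) hBv) hBc.isClosed)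
      fun k hk => mem_closure_convexHull_of_norming hbal hnorm ((hBmem k).1 hk)
  refine mem_of_mem_extremePoints_closure_convexHull hK (hhull ▸ hBc) ?_
  rw [hhull]
  exact hφ

end Dual

/-! ### Continuous right inverses of meromorphic functions -/

theorem isPreconnected_ball_diff_center (c : ℂ) {r : ℝ} (hr : 0 < r) :
    IsPreconnected (Metric.ball c r \ {c}) := by
  have h : Metric.ball c r \ {c} = (fun s => c + Complex.exp s) '' {s : ℂ | s.re < Real.log r} := by
    ext z
    simp only [Set.mem_sdiff, Metric.mem_ball, Set.mem_singleton_iff, Set.mem_image,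
      Set.mem_ofPred_eq, dist_eq_norm]
    constructor
    · rintro ⟨h1, h2⟩
      have h3 : z - c ≠ 0 := sub_ne_zero.2 h2
      refine ⟨Complex.log (z - c), ?_, by rw [Complex.exp_log h3]; ring⟩
      rw [Complex.log_re]
      exact Real.log_lt_log (norm_pos_iff.2 h3) h1
    · rintro ⟨s, hs, rfl⟩
      refine ⟨?_, by simp [Complex.exp_ne_zero]⟩
      rw [add_sub_cancel_left, Complex.norm_exp]
      exact (Real.lt_log_iff_exp_lt hr).1 hs
  rw [h]
  refine IsPreconnected.image ?_ _ (by fun_prop)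
  exact (convex_halfSpace_re_lt _).isPreconnected

/-- A continuous right inverse of an analytic function is analytic. -/
theorem analyticAt_of_continuousAt_rightInverse {φ ψ : ℂ → ℂ} {z : ℂ}
    (hψ : ∀ᶠ u in 𝓝 z, ContinuousAt ψ u) (hφ : AnalyticAt ℂ φ (ψ z))
    (hφψ : ∀ᶠ u in 𝓝 z, φ (ψ u) = u) : AnalyticAt ℂ ψ z := by
  have hψz : ContinuousAt ψ z := hψ.self_of_nhds
  have hd : ∀ᶠ y in 𝓝[≠] ψ z, deriv φ y ≠ 0 := by
    -- If `φ` were locally constant, `φ ∘ ψ = id` would collapse a neighbourhood of `z` to a point.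
    -- So critical points are isolated: the inverse function rule applies off `z`, and continuity
    -- removes the singularity at `z`.
    refine hφ.deriv.eventually_eq_zero_or_eventually_ne_zero.resolve_left fun h0 => ?_
    obtain ⟨r, hr, hball⟩ := Metric.eventually_nhds_iff_ball.1 (h0.and hφ.eventually_analyticAt)
    have hconst : ∀ y ∈ Metric.ball (ψ z) r, φ y = φ (ψ z) := fun y hy =>
      Metric.isOpen_ball.is_const_of_deriv_eq_zero (convex_ball _ _).isPreconnected
        (fun u hu => (hball u hu).2.differentiableAt.differentiableWithinAt)
        (fun u hu => (hball u hu).1) hy (Metric.mem_ball_self hr)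
    have h1 : ∀ᶠ u in 𝓝 z, u = z := by
      filter_upwards [hφψ, hψz.eventually (Metric.ball_mem_nhds _ hr)] with u hu hu'
      rw [← hu, hconst _ hu', hφψ.self_of_nhds]
    have h2 : ∀ᶠ u in 𝓝[≠] z, u = z := h1.filter_mono nhdsWithin_le_nhds
    obtain ⟨u, hu, hu'⟩ := (h2.and self_mem_nhdsWithin).exists
    exact hu' hu
  refine Complex.analyticAt_of_differentiable_on_punctured_nhds_of_continuousAt ?_ hψz
  have htend : Tendsto ψ (𝓝[≠] z) (𝓝[≠] ψ z) := by
    refine tendsto_nhdsWithin_iff.2 ⟨hψz.mono_left nhdsWithin_le_nhds, ?_⟩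
    filter_upwards [hφψ.filter_mono nhdsWithin_le_nhds, self_mem_nhdsWithin] with u hu hne heq
    apply hne
    rw [Set.mem_singleton_iff] at heq ⊢
    rw [← hu, heq, hφψ.self_of_nhds]
  filter_upwards [htend.eventually hd, hψ.filter_mono nhdsWithin_le_nhds,
    (hψz.eventually hφ.eventually_analyticAt).filter_mono nhdsWithin_le_nhds,
    hφψ.eventually_nhds.filter_mono nhdsWithin_le_nhds] with u h1 h2 h3 h4
  exact (HasDerivAt.of_local_left_inverse h2 h3.differentiableAt.hasDerivAt h1 h4).differentiableAt

section

variable {V : Set ℂ} {G H ψ : ℂ → ℂ}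

theorem analyticOnNhd_of_mul_eq (hVo : IsOpen V) (hG : DifferentiableOn ℂ G V)
    (hH : DifferentiableOn ℂ H V) (hψc : ContinuousOn ψ disc) (hψV : Set.MapsTo ψ disc V)
    (hHψ : ∀ z ∈ disc, H (ψ z) ≠ 0) (hGψ : ∀ z ∈ disc, G (ψ z) = z * H (ψ z)) :
    AnalyticOnNhd ℂ ψ disc := by
  intro z hz
  have hD : disc ∈ 𝓝 z := Metric.isOpen_ball.mem_nhds hz
  refine analyticAt_of_continuousAt_rightInverse (φ := fun y => G y / H y) ?_ ?_ ?_
  · filter_upwards [Metric.isOpen_ball.eventually_mem hz] with u hu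
    exact hψc.continuousAt (Metric.isOpen_ball.mem_nhds hu)
  · exact (hG.analyticOnNhd hVo _ (hψV hz)).div (hH.analyticOnNhd hVo _ (hψV hz)) (hHψ z hz)
  · filter_upwards [hD] with u hu
    rw [hGψ u hu, mul_div_cancel_right₀ _ (hHψ u hu)]

/-- Let `ψ` be a continuous map from the disc into a domain `V`, right inverse to the quotient
`G / H`, whose image is relatively closed away from the zeros of `H`. Then `ψ` is onto. -/
theorem subset_image_disc_of_mul_eq (hVo : IsOpen V) (hVc : IsPreconnected V)
    (hG : DifferentiableOn ℂ G V) (hH : DifferentiableOn ℂ H V)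
    (hψc : ContinuousOn ψ disc) (hψV : Set.MapsTo ψ disc V)
    (hHψ : ∀ z ∈ disc, H (ψ z) ≠ 0) (hGψ : ∀ z ∈ disc, G (ψ z) = z * H (ψ z))
    (hcl : ∀ y ∈ V, y ∈ closure (ψ '' disc) → H y ≠ 0 → y ∈ ψ '' disc) :
    V ⊆ ψ '' disc := by
  have h0 : (0 : ℂ) ∈ disc := Metric.mem_ball_self one_pos
  have hinv : ∀ z ∈ disc, G (ψ z) / H (ψ z) = z := fun z hz => by
    rw [hGψ z hz, mul_div_cancel_right₀ _ (hHψ z hz)]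
  have hψa := analyticOnNhd_of_mul_eq hVo hG hH hψc hψV hHψ hGψ
  have hopen : IsOpen (ψ '' disc) := by
    rcases hψa.is_constant_or_isOpen (convex_ball _ _).isPreconnected with ⟨w, hw⟩ | h
    · exfalso
      have h1 : (1 / 2 : ℂ) ∈ disc := by simp; norm_num
      have h2 := hinv _ h1
      rw [hw _ h1, ← hw 0 h0, hinv 0 h0] at h2
      norm_num at h2
    · exact h _ subset_rfl Metric.isOpen_ball
  refine hVc.subset_of_closure_inter_subset hopen
    ⟨ψ 0, hψV h0, Set.mem_image_of_mem ψ h0⟩ ?_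
  rintro y ⟨hycl, hyV⟩
  by_cases hHy : H y ≠ 0
  · exact hcl y hyV hycl hHy
  have hHa := hH.analyticOnNhd hVo
  -- A zero of `H` is isolated, since `H` does not vanish identically on the connected set `V`.
  have hne : ∀ᶠ u in 𝓝[≠] y, H u ≠ 0 := by
    refine (hHa y hyV).eventually_eq_zero_or_eventually_ne_zero.resolve_left fun h => ?_
    exact hHψ 0 h0 (hHa.eqOn_zero_of_preconnected_of_eventuallyEq_zero hVc hyV h (hψV h0))
  obtain ⟨r, hr, hball⟩ := Metric.eventually_nhds_iff_ball.1
    ((eventually_nhdsWithin_iff.1 hne).and (hVo.eventually_mem hyV))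
  have hyψ : y ∉ ψ '' disc := by
    rintro ⟨z, hz, rfl⟩
    exact hHy (hHψ z hz)
  -- The image is open and relatively closed in this connected punctured ball, so it fills it. There
  -- `φ = G / H` takes values in the disc, hence extends across `y`.
  have hW : Metric.ball y r \ {y} ⊆ ψ '' disc := by
    refine (isPreconnected_ball_diff_center y hr).subset_of_closure_inter_subset hopen ?_ ?_
    · obtain ⟨u, hu, hu'⟩ := mem_closure_iff.1 hycl _ Metric.isOpen_ball (Metric.mem_ball_self hr)
      exact ⟨u, ⟨hu, fun h => hyψ (h ▸ hu')⟩, hu'⟩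
    · rintro u ⟨hu, hu', hu''⟩
      exact hcl u (hball u hu').2 hu ((hball u hu').1 hu'')
  set φ : ℂ → ℂ := fun u => G u / H u with hφdef
  have hφD : ∀ u ∈ Metric.ball y r \ {y}, φ u ∈ disc ∧ ψ (φ u) = u := by
    intro u hu
    obtain ⟨z, hz, rfl⟩ := hW hu
    have : φ (ψ z) = z := hinv z hz
    rw [this]
    exact ⟨hz, rfl⟩
  set a := limUnder (𝓝[≠] y) φ with ha
  have hext : DifferentiableOn ℂ (Function.update φ y a) (Metric.ball y r) := by
    refine Complex.differentiableOn_update_limUnder_of_bddAbove (Metric.ball_mem_nhds y hr) ?_ ?_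
    · intro u hu
      exact ((hG.differentiableAt (hVo.mem_nhds (hball u hu.1).2)).div
        (hH.differentiableAt (hVo.mem_nhds (hball u hu.1).2))
        ((hball u hu.1).1 hu.2)).differentiableWithinAt
    · refine ⟨1, ?_⟩
      rintro _ ⟨u, hu, rfl⟩
      exact (mem_ball_zero_iff.1 (hφD u hu).1).le
  have hpunct : ∀ᶠ u in 𝓝[≠] y, u ∈ Metric.ball y r \ {y} :=
    sdiff_mem_nhdsWithin_compl (Metric.ball_mem_nhds y hr) _
  have hcont : Tendsto φ (𝓝[≠] y) (𝓝 a) :=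
    continuousAt_update_same.1 (hext.differentiableAt (Metric.ball_mem_nhds y hr)).continuousAt
  have ha1 : ‖a‖ ≤ 1 := le_of_tendsto hcont.norm
    (hpunct.mono fun u hu => (mem_ball_zero_iff.1 (hφD u hu).1).le)
  have haD : a ∈ disc := by
    rw [mem_ball_zero_iff]
    refine ha1.lt_of_ne fun ha2 => ?_
    -- If `‖a‖ = 1`, the maximum principle would give `‖φ‖ = 1` near `y`, against `‖φ‖ < 1` off `y`.
    have hmax : IsLocalMax (norm ∘ Function.update φ y a) y := by
      filter_upwards [Metric.ball_mem_nhds y hr] with u hu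
      by_cases huy : u = y
      · rw [huy]
      · simpa [huy, ha2] using (mem_ball_zero_iff.1 (hφD u ⟨hu, huy⟩).1).le
    have heq := Complex.norm_eventually_eq_of_isLocalMax
      (hext.eventually_differentiableAt (Metric.ball_mem_nhds y hr)) hmax
    obtain ⟨u, hu, hu'⟩ := ((heq.filter_mono nhdsWithin_le_nhds).and hpunct).exists
    have huy : u ≠ y := hu'.2
    have h3 := mem_ball_zero_iff.1 (hφD u hu').1
    simp [huy, ha2] at hu
    exact h3.ne hu
  have hlim : Tendsto (fun u => ψ (φ u)) (𝓝[≠] y) (𝓝 (ψ a)) :=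
    (hψc.continuousAt (Metric.isOpen_ball.mem_nhds haD)).tendsto.comp hcont
  have hlim' : Tendsto (fun u => ψ (φ u)) (𝓝[≠] y) (𝓝 y) :=
    (tendsto_id.mono_left nhdsWithin_le_nhds).congr'
      (hpunct.mono fun u hu => (hφD u hu).2.symm)
  exact ⟨a, haD, tendsto_nhds_unique hlim hlim'⟩

end

/-! ### Pulling evaluations back along the isometry -/

section

variable {U V : Set ℂ} {v : Weight U} {w : Weight V}

theorem IsHolomorphic.continuous {f : U → ℂ} (hf : IsHolomorphic f) : Continuous f := by
  obtain ⟨F, hF, hFf⟩ := hf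
  have h : f = U.domRestrict F := funext fun z => (hFf z).symm
  rw [h]
  exact hF.continuousOn.domRestrict

theorem continuous_weight_mul_norm (f : H v) : Continuous fun z => v z * ‖f z‖ :=
  v.continuous'.mul f.2.1.continuous.norm

/-- The functional `f ↦ w(y) (Tf)(y)`, extended by `0` to the point at infinity. -/
def transposeEval (T : Ho v →ₗᵢ[ℂ] Ho w) (y : OnePoint V) : WeakDual ℂ (Ho v) :=
  y.elim 0 fun y => StrongDual.toWeakDual
    ((w y : ℂ) • (delta w y).comp T.toContinuousLinearMap)

theorem transposeEval_coe (T : Ho v →ₗᵢ[ℂ] Ho w) (y : V) (f : Ho v) :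
    transposeEval T y f = w y * (T f).1 y := rfl

theorem transposeEval_infty (T : Ho v →ₗᵢ[ℂ] Ho w) (f : Ho v) :
    transposeEval T OnePoint.infty f = 0 := rfl

theorem norm_transposeEval_coe (T : Ho v →ₗᵢ[ℂ] Ho w) (y : V) (f : Ho v) :
    ‖transposeEval T y f‖ = w y * ‖(T f).1 y‖ := by
  rw [transposeEval_coe, norm_mul, Complex.norm_real, Real.norm_of_nonneg (w.pos' y).le]

/-- Continuity at infinity is exactly the boundary condition defining `Ho w`. -/
theorem continuous_transposeEval (T : Ho v →ₗᵢ[ℂ] Ho w) : Continuous (transposeEval T) := by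
  refine WeakDual.continuous_of_continuous_eval fun f => (OnePoint.continuous_iff _).2 ⟨?_, ?_⟩
  · rw [coclosedCompact_eq_cocompact, transposeEval_infty, tendsto_zero_iff_norm_tendsto_zero]
    simp only [norm_transposeEval_coe]
    exact (T f).2
  · simp only [transposeEval_coe]
    exact (Complex.continuous_ofReal.comp w.continuous').mul (T f).1.2.1.continuous

/-- A nonzero extreme evaluation functional is, up to a unimodular factor, the pull-back of an
evaluation functional under any linear isometry. -/
theorem exists_eval_of_mem_vBoundary (hV : V.Nonempty) (T : Ho v →ₗᵢ[ℂ] Ho w) {z : U}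
    (hz : z ∈ vBoundary v) (hz0 : ∃ f : Ho v, f.1 z ≠ 0) :
    ∃ (y : V) (c : ℂ), ‖c‖ = 1 ∧ ∀ f : Ho v, c * (w y * (T f).1 y) = v z * f.1 z := by
  have : Nonempty V := hV.to_subtype
  set K : Set (WeakDual ℂ (Ho v)) :=
    (fun p : ℂ × OnePoint V => p.1 • transposeEval T p.2) '' (Metric.sphere 0 1 ×ˢ Set.univ)
    with hKdef
  have hK : IsCompact K := ((isCompact_sphere (0 : ℂ) 1).prod isCompact_univ).image
    (continuous_fst.smul ((continuous_transposeEval T).comp continuous_snd))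
  have hnorm_smul : ∀ (c : ℂ) (y : OnePoint V) (f : Ho v), ‖c‖ = 1 →
      ‖(c • transposeEval T y) f‖ = ‖transposeEval T y f‖ := fun c y f hc => by
    change ‖c * transposeEval T y f‖ = _
    rw [norm_mul, hc, one_mul]
  have hbal : ∀ c : ℂ, ‖c‖ = 1 → ∀ k ∈ K, c • k ∈ K := by
    rintro c hc _ ⟨⟨d, y⟩, ⟨hd, -⟩, rfl⟩
    rw [mem_sphere_zero_iff_norm] at hd
    exact ⟨(c * d, y), ⟨by simp [hc, hd], trivial⟩, mul_smul c d _⟩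
  have hle : ∀ k ∈ K, ∀ f, ‖k f‖ ≤ ‖f‖ := by
    rintro _ ⟨⟨d, y⟩, ⟨hd, -⟩, rfl⟩ f
    rw [mem_sphere_zero_iff_norm] at hd
    rw [hnorm_smul d y f hd]
    induction y using OnePoint.rec with
    | infty => rw [transposeEval_infty, norm_zero]; exact norm_nonneg f
    | coe y =>
      rw [norm_transposeEval_coe, ← T.norm_map f]
      exact H.weight_mul_le_norm (T f).1 y
  have hnorm : ∀ (f : Ho v) (C : ℝ), (∀ k ∈ K, ‖k f‖ ≤ C) → ‖f‖ ≤ C := by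
    intro f C hC
    rw [← T.norm_map f]
    refine ciSup_le (f := fun y : V => w y * ‖(T f).1 y‖) fun y => ?_
    have h := hC _ ⟨(1, (y : OnePoint V)), ⟨by simp, trivial⟩, rfl⟩
    rwa [hnorm_smul _ _ _ norm_one, norm_transposeEval_coe] at h
  obtain ⟨⟨c, y⟩, ⟨hc, -⟩, hy⟩ := mem_of_mem_extremePoints_closedBall hK hbal hle hnorm hz
  have hyf : ∀ f : Ho v, c * transposeEval T y f = v z * f.1 z := fun f =>
    congrArg (fun k : WeakDual ℂ (Ho v) => k f) hy
  induction y using OnePoint.rec with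
  | infty =>
    obtain ⟨f, hf⟩ := hz0
    have h := hyf f
    rw [transposeEval_infty, mul_zero, eq_comm] at h
    exact absurd h (mul_ne_zero (Complex.ofReal_ne_zero.2 (v.pos' z).ne') hf)
  | coe y => exact ⟨y, c, by simpa using hc, hyf⟩

/-- A bounded holomorphic function belongs to `H_{v_o}` when `v` vanishes at the boundary. -/
def ofBounded (hv0 : VanishesAtBoundary v) (F : ℂ → ℂ) (hF : Differentiable ℂ F)
    (hF1 : ∀ z : U, ‖F z‖ ≤ 1) : Ho v where
  val := ⟨fun z => F z, ⟨F, hF.differentiableOn, fun _ => rfl⟩, by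
    obtain ⟨C, hC⟩ := v.bounded'
    refine ⟨C, ?_⟩
    rintro _ ⟨z, rfl⟩
    exact (mul_le_of_le_one_right (v.pos' z).le (hF1 z)).trans (hC z)⟩
  property := squeeze_zero (fun z => mul_nonneg (v.pos' z).le (norm_nonneg _))
    (fun z => mul_le_of_le_one_right (v.pos' z).le (hF1 z)) hv0

theorem exists_mem_eq_one_and_sub {A : Submodule ℂ (H w)} (hA : ContainsDegreeOne A) :
    (∃ f ∈ A, ∀ y, f y = 1) ∧ ∀ a : ℂ, ∃ f ∈ A, ∀ y : V, f y = y - a := by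
  have hsub : ∀ a : ℂ, ∃ f ∈ A, ∀ y : V, f y = y - a := fun a => by
    obtain ⟨f, hf, hfy⟩ := hA (Polynomial.X - Polynomial.C a) (Polynomial.degree_X_sub_C a)
    exact ⟨f, hf, fun y => by simpa using hfy y⟩
  refine ⟨?_, hsub⟩
  obtain ⟨f, hf, hfy⟩ := hsub 0
  obtain ⟨g, hg, hgy⟩ := hsub 1
  refine ⟨f + (-1 : ℂ) • g, A.add_mem hf (A.smul_mem _ hg), fun y => ?_⟩
  rw [H.add_apply, H.smul_apply, hfy, hgy]
  ring

theorem stronglySeparates_of_containsDegreeOne {A : Submodule ℂ (H w)}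
    (hA : ContainsDegreeOne A) : StronglySeparates w A := by
  intro x y hxy
  obtain ⟨f, hf, hfy⟩ := (exists_mem_eq_one_and_sub hA).2 x
  refine ⟨f, hf, ?_⟩
  have h : (y : ℂ) - x ≠ 0 := sub_ne_zero.2 fun h => hxy (Subtype.ext h.symm)
  rw [hfy, hfy, sub_self, norm_zero, mul_zero]
  exact (mul_pos (w.pos' y) (norm_pos_iff.2 h)).ne

theorem mem_rangeIn {T : Ho v →ₗᵢ[ℂ] Ho w} {g : H w} : g ∈ rangeIn T ↔ ∃ f, (T f).1 = g := by
  constructor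
  · rintro ⟨_, ⟨f, rfl⟩, rfl⟩
    exact ⟨f, rfl⟩
  · rintro ⟨f, rfl⟩
    exact ⟨_, ⟨f, rfl⟩, rfl⟩

theorem containsDegreeOne_of_surjective (hw : ContainsDegreeOne (Ho w)) {T : Ho v →ₗᵢ[ℂ] Ho w}
    (hT : Function.Surjective T) : ContainsDegreeOne (rangeIn T) := by
  intro p hp
  obtain ⟨g, hg, hgp⟩ := hw p hp
  obtain ⟨f, hf⟩ := hT ⟨g, hg⟩
  exact ⟨g, mem_rangeIn.2 ⟨f, by rw [hf]⟩, hgp⟩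

/-- A set on which a function vanishing at the boundary is bounded below lies in a compact set. -/
theorem VanishesAtBoundary.exists_isCompact {g : U → ℝ} (hg : VanishesAtBoundary g) {c : ℝ}
    (hc : 0 < c) : ∃ K : Set U, IsCompact K ∧ ∀ z, c ≤ g z → z ∈ K := by
  obtain ⟨K, hK, hKs⟩ := mem_cocompact.1 (Tendsto.eventually_lt_const hc hg)
  refine ⟨K, hK, fun z hz => ?_⟩
  by_contra hzK
  exact absurd (hKs hzK) (not_lt.2 hz)

/-- A map intertwining the moduli of weighted functions is continuous when the range of the
isometry separates strongly. -/
theorem continuous_of_weight_mul_norm_eq {T : Ho v →ₗᵢ[ℂ] Ho w}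
    (hsep : StronglySeparates w (rangeIn T)) {Ψ : U → V}
    (hΨ : ∀ z (f : Ho v), w (Ψ z) * ‖(T f).1 (Ψ z)‖ = v z * ‖f.1 z‖)
    (h0 : ∀ z, ∃ f : Ho v, f.1 z ≠ 0) : Continuous Ψ := by
  refine continuous_iff_continuousAt.2 fun z => tendsto_iff_ultrafilter _ _ _ |>.2 fun u hu => ?_
  have hconv : ∀ f : Ho v, Tendsto (fun z => w (Ψ z) * ‖(T f).1 (Ψ z)‖) u
      (𝓝 (v z * ‖f.1 z‖)) := fun f => by
    simp only [hΨ]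
    exact ((continuous_weight_mul_norm f.1).tendsto z).mono_left hu
  obtain ⟨f, hf⟩ := h0 z
  have hpos : 0 < v z * ‖f.1 z‖ := mul_pos (v.pos' z) (norm_pos_iff.2 hf)
  obtain ⟨L, hL, hLs⟩ := VanishesAtBoundary.exists_isCompact (T f).2 (half_pos hpos)
  -- The lower bound on `w|Tf|` confines `Ψ` to a compact set along the ultrafilter. A limit `y`
  -- there has the same weighted moduli as `Ψ z`, so separation identifies them.
  have hmem : ∀ᶠ z in u, Ψ z ∈ L :=
    ((hconv f).eventually_const_le (half_lt_self hpos)).mono fun z hz => hLs _ hz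
  obtain ⟨y, -, hy⟩ := hL.ultrafilter_le_nhds (u.map Ψ) (le_principal_iff.2 hmem)
  suffices hyz : y = Ψ z by rw [← hyz]; exact hy
  by_contra hne
  obtain ⟨g, hg, hgne⟩ := hsep y (Ψ z) hne
  obtain ⟨f, rfl⟩ := mem_rangeIn.1 hg
  refine hgne ((tendsto_nhds_unique ?_ (hconv f)).trans (hΨ z f).symm)
  exact ((continuous_weight_mul_norm (T f).1).tendsto y).comp hy

end

/-! ### Surjectivity from strong separation -/

section

variable {V : Set ℂ} {v : Weight disc} {w : Weight V}

theorem surjective_of_stronglySeparates (hVo : IsOpen V) (hVc : IsConnected V)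
    (hv : v.IsComplete) (hv0 : VanishesAtBoundary v) (T : Ho v →ₗᵢ[ℂ] Ho w)
    (hsep : StronglySeparates w (rangeIn T)) : Function.Surjective T := by
  set one : Ho v := ofBounded hv0 (fun _ => 1) (by fun_prop) (fun _ => by simp)
  set ident : Ho v := ofBounded hv0 (fun z => z) (by fun_prop)
    (fun z => (mem_ball_zero_iff.1 z.2).le)
  have hone : ∀ z, one.1 z = 1 := fun _ => rfl
  have hident : ∀ z : disc, ident.1 z = z := fun _ => rfl
  have hne : ∀ z, ∃ f : Ho v, f.1 z ≠ 0 := fun z => ⟨one, by rw [hone]; exact one_ne_zero⟩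
  have hex : ∀ z : disc, ∃ (y : V) (c : ℂ), ‖c‖ = 1 ∧
      ∀ f : Ho v, c * (w y * (T f).1 y) = v z * f.1 z := fun z =>
    exists_eval_of_mem_vBoundary hVc.nonempty T (hv ▸ Set.mem_univ z) (hne z)
  choose Ψ c hc hΨ using hex
  have hmod : ∀ z (f : Ho v), w (Ψ z) * ‖(T f).1 (Ψ z)‖ = v z * ‖f.1 z‖ := by
    intro z f
    have h := congrArg norm (hΨ z f)
    simpa [hc, abs_of_pos (w.pos' _), abs_of_pos (v.pos' _)] using h
  have hΨc : Continuous Ψ := continuous_of_weight_mul_norm_eq hsep hmod hne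
  set h := (T one).1
  have hh0 : ∀ z, h (Ψ z) ≠ 0 := by
    intro z h0
    have h1 := hmod z one
    rw [hone, norm_one, mul_one, h0, norm_zero, mul_zero] at h1
    exact (v.pos' z).ne h1
  have hTf : ∀ z (f : Ho v), (T f).1 (Ψ z) = f.1 z * h (Ψ z) := by
    intro z f
    have hvz : (v z : ℂ) ≠ 0 := Complex.ofReal_ne_zero.2 (v.pos' z).ne'
    have h1 := hΨ z f
    have h2 := hΨ z one
    rw [hone] at h2
    refine mul_left_cancel₀ hvz ?_
    -- Comparing with the constant function `1` eliminates `c z` and `w (Ψ z)`.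
    linear_combination (h (Ψ z)) * h1 - (T f).1 (Ψ z) * h2
  obtain ⟨G, hG, hGg⟩ := (T ident).1.2.1
  obtain ⟨F, hF, hFh⟩ := h.2.1
  set ψ : ℂ → ℂ := Function.extend Subtype.val (fun z => (Ψ z : ℂ)) 0
  have hψ : ∀ z : disc, ψ z = Ψ z := fun z => Subtype.val_injective.extend_apply _ _ z
  have himage : ψ '' disc = Set.range fun z => (Ψ z : ℂ) := by
    rw [Set.image_eq_range]
    exact congrArg _ (funext hψ)
  have hψc : ContinuousOn ψ disc := by
    rw [continuousOn_iff_continuous_domRestrict]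
    exact (continuous_subtype_val.comp hΨc).congr fun z => (hψ z).symm
  have hψV : Set.MapsTo ψ disc V := fun z hz => by rw [hψ ⟨z, hz⟩]; exact (Ψ _).2
  have hHψ : ∀ z ∈ disc, F (ψ z) ≠ 0 := fun z hz => by
    rw [hψ ⟨z, hz⟩, hFh]
    exact hh0 _
  have hGψ : ∀ z ∈ disc, G (ψ z) = z * F (ψ z) := fun z hz => by
    rw [hψ ⟨z, hz⟩, hFh, hGg]
    exact hTf ⟨z, hz⟩ ident
  have hcl : ∀ y ∈ V, y ∈ closure (ψ '' disc) → F y ≠ 0 → y ∈ ψ '' disc := by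
    intro y hy hycl hFy
    have hhy : h ⟨y, hy⟩ ≠ 0 := by rwa [← hFh ⟨y, hy⟩]
    have hpos : 0 < w ⟨y, hy⟩ * ‖h ⟨y, hy⟩‖ := mul_pos (w.pos' _) (norm_pos_iff.2 hhy)
    -- Since `w|h| ∘ Ψ = v`, image points near `y` come from the set where `v` is at least half of
    -- `w(y)|h(y)|`, hence from the compact `K`, whose image is closed.
    obtain ⟨K, hK, hKs⟩ := hv0.exists_isCompact (half_pos hpos)
    have hKcl : IsClosed ((fun z => (Ψ z : ℂ)) '' K) :=
      (hK.image (continuous_subtype_val.comp hΨc)).isClosed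
    have hnear : ∀ᶠ u in 𝓝 y, ∀ hu : u ∈ V,
        w ⟨y, hy⟩ * ‖h ⟨y, hy⟩‖ / 2 < w ⟨u, hu⟩ * ‖h ⟨u, hu⟩‖ := by
      have h1 := ((continuous_weight_mul_norm h).tendsto ⟨y, hy⟩).eventually_const_lt
        (half_lt_self hpos)
      rw [nhds_subtype_eq_comap, eventually_comap] at h1
      exact h1.mono fun u hu huV => hu ⟨u, huV⟩ rfl
    have hyK : y ∈ closure ((fun z => (Ψ z : ℂ)) '' K) := by
      rw [mem_closure_iff_frequently] at hycl ⊢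
      refine (hycl.and_eventually hnear).mono ?_
      rintro u ⟨hu, hu'⟩
      rw [himage] at hu
      obtain ⟨z, rfl⟩ := hu
      refine ⟨z, hKs z ?_, rfl⟩
      have h2 := hu' (Ψ z).2
      have h3 := hmod z one
      rw [hone, norm_one, mul_one] at h3
      exact (h2.trans_eq h3).le
    rw [hKcl.closure_eq] at hyK
    rw [himage]
    exact Set.image_subset_range _ _ hyK
  have honto := subset_image_disc_of_mul_eq hVo hVc.isPreconnected hG hF hψc hψV hHψ hGψ hcl
  have hΨs : Function.Surjective Ψ := by
    intro y
    obtain ⟨z, hz⟩ := himage ▸ honto y.2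
    exact ⟨z, Subtype.ext hz⟩
  have hψd : DifferentiableOn ℂ ψ disc :=
    (analyticOnNhd_of_mul_eq hVo hG hF hψc hψV hHψ hGψ).differentiableOn
  have hquot : ∀ z, (T ident).1 (Ψ z) / h (Ψ z) = z := fun z => by
    rw [hTf, mul_div_cancel_right₀ _ (hh0 z), hident]
  -- `T(id) / h` is a continuous left inverse, as surjectivity of `Ψ` keeps `h` zero-free. Hence `Ψ`
  -- is proper and transports vanishing at the boundary from `V` to the disc.
  have hΨcl : IsClosedEmbedding Ψ := by
    have hD : ∀ y, (T ident).1 y / h y ∈ disc := fun y => by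
      obtain ⟨z, rfl⟩ := hΨs y
      rw [hquot]
      exact z.2
    refine Function.LeftInverse.isClosedEmbedding (f := fun y => ⟨_, hD y⟩)
      (fun z => Subtype.ext (hquot z)) (Continuous.subtype_mk ?_ _) hΨc
    refine (T ident).1.2.1.continuous.div h.2.1.continuous fun y => ?_
    obtain ⟨z, rfl⟩ := hΨs y
    exact hh0 z
  intro g
  obtain ⟨G', hG', hGg'⟩ := g.1.2.1
  have hmod' : ∀ z, v z * ‖g.1 (Ψ z) / h (Ψ z)‖ = w (Ψ z) * ‖g.1 (Ψ z)‖ := fun z => by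
    have h3 := hmod z one
    rw [hone, norm_one, mul_one] at h3
    rw [← h3, norm_div, mul_assoc, mul_div_cancel₀ _ (norm_ne_zero_iff.2 (hh0 z))]
  have hhol : IsHolomorphic fun z : disc => g.1 (Ψ z) / h (Ψ z) := by
    refine ⟨fun z => G' (ψ z) / F (ψ z), ?_, fun z => ?_⟩
    · exact (hG'.comp hψd hψV).div (hF.comp hψd hψV) hHψ
    · change G' (ψ z) / F (ψ z) = g.1 (Ψ z) / h (Ψ z)
      rw [hψ, hGg', hFh]
  have hbdd : BddAbove (Set.range fun z => v z * ‖g.1 (Ψ z) / h (Ψ z)‖) := by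
    refine ⟨‖g.1‖, ?_⟩
    rintro _ ⟨z, rfl⟩
    simp only [hmod']
    exact H.weight_mul_le_norm g.1 _
  refine ⟨⟨⟨fun z => g.1 (Ψ z) / h (Ψ z), hhol, hbdd⟩, ?_⟩, ?_⟩
  · have hvan : Tendsto (fun z => w (Ψ z) * ‖g.1 (Ψ z)‖) (cocompact disc) (𝓝 0) :=
      (show Tendsto _ _ _ from g.2).comp hΨcl.tendsto_cocompact
    exact hvan.congr fun z => (hmod' z).symm
  · refine Subtype.ext (Subtype.ext (funext fun y => ?_))
    obtain ⟨z, rfl⟩ := hΨs y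
    exact (hTf z _).trans (div_mul_cancel₀ _ (hh0 z))

end

end WeightedHol

end

theorem theorem3p1 (V : Set ℂ) (hVo : IsOpen V) (hVc : IsConnected V)
    (v : WeightedHol.Weight WeightedHol.disc) (hv : v.IsComplete)
    (hv0 : WeightedHol.VanishesAtBoundary v)
    (w : WeightedHol.Weight V) (hw : WeightedHol.ContainsDegreeOne (WeightedHol.Ho w))
    (T : WeightedHol.Ho v →ₗᵢ[ℂ] WeightedHol.Ho w) :
    List.TFAE [Function.Surjective T,
      WeightedHol.StronglySeparates w (WeightedHol.rangeIn T),
      WeightedHol.ContainsDegreeOne (WeightedHol.rangeIn T)] := by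
  tfae_have 1 → 3 := WeightedHol.containsDegreeOne_of_surjective hw
  tfae_have 3 → 2 := WeightedHol.stronglySeparates_of_containsDegreeOne
  tfae_have 2 → 1 := WeightedHol.surjective_of_stronglySeparates hVo hVc hv hv0 T
  tfae_finish
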